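/- Let $X$ be an infinite-dimensional real Banach space and let $p\in\{1,2,3,\dots\}\cup\{\infty\}$. A bump function on $X$ is a function $b\colon X\to\mathbb{R}$ that is not identically zero and whose support $\operatorname{supp} b=\overline{\{x\in X: b(x)\neq 0\}}$ is bounded. 1. If $b$ is a $C^p$ smooth bump function on $X$, then there is another $C^p$ smooth bump function $f\colon X\to[0,1]$, $f\ne b$, such that $f'(x)\neq 0$ for every $x$ in the interior of $\operatorname{supp} f$. 2. If $b$ is a $C^p$ smooth Lipschitz bump function on $X$, then there is another $C^p$ smooth Lipschitz bump function $f\colon X\to[0,1]$, $f\ne b$, such that $f'(x)\neq 0$ for every $x$ in the interior of $\operatorname{supp} f$. In particular, if $X$ has a $C^p$ smooth bump function, then Rolle's theorem fails in $X$: there are a nonempty bounded open set $U\subset X$ and a continuous function $f\colon\overline{U}\to\mathbb{R}$ that is differentiable in $U$ and constant on $\partial U$, such that $f'(x)\neq 0$ for every $x\in U$. -/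

import Mathlib

/-- A bump function on `X`: a real function, not constantly zero, whose (closed) support
`closure {x | b x ≠ 0}` is bounded. -/
def IsBump {X : Type*} [NormedAddCommGroup X] (b : X → ℝ) : Prop :=
  (∃ x, b x ≠ 0) ∧ Bornology.IsBounded (tsupport b)

/-- Rolle's theorem holds in `X`: for every nonempty bounded open `U`, every function continuous
on `closure U`, differentiable in `U` and constant on the boundary of `U` has a critical point
in `U`. -/
def RolleHolds (X : Type*) [NormedAddCommGroup X] [NormedSpace ℝ X] : Prop :=
  ∀ U : Set X, U.Nonempty → Bornology.IsBounded U → IsOpen U →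
    ∀ f : X → ℝ, ContinuousOn f (closure U) → DifferentiableOn ℝ f U →
      (∃ c : ℝ, ∀ x ∈ frontier U, f x = c) → ∃ x ∈ U, fderiv ℝ f x = 0

/-!
In infinite dimensions a ray surrounded by a thin tube can be folded up, without self-contact, into
a bounded set. A function that grows along the ray and drops off transversally has no critical
point, because its supremum is only approached far along the ray; transported to the folded tube it
has bounded support.

The folding needs no implicit function theorem, since it is a composition of two shears. Split `X`
as `ℝ e ⊕ ker l`, with projection `P` onto `ker l`. Let `γ` be a smooth bounded path in `ker l`
that stays away from its own past (`exists_slow_separated_path`), and let `T` be a `C^p` "clock",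
a function on `X` with `T (γ s + y) = s + O(1)` for `s ≥ 0` and small `y` (`exists_clock`). The map
`(s, y) ↦ (γ s + y) + (s - T (γ s + y)) • e` is the shear by `γ` followed by the shear by `-T`;
its inverse is `x ↦ (S x, P x - γ (S x))` with `S x = l x + T (P x)`. The first shear makes the
transversal part bounded along the ray, the second one the height. With a `C^p` plateau function
`χ ≤ 1` that is `1` near `0` and vanishes off a ball (built from the given bump), and a small
`ε > 0`, put

  `u x = χ (ε⁻¹ • (P x - γ (S x))) - 2 * exp (-S x)`.

In the coordinates `(s, y)` the partial derivative of `u` in `s` is `2 * exp (-s)`, so `u` has no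
critical point at all; `0 ≤ u` forces `s > 0` and `‖y‖ < ε`, so `{u ≥ 0}` is bounded
(`exists_critical_point_free`). A positive multiple of `expNegInvGlue ∘ u` is the desired bump. Its
support lies in `{u ≥ 0}`, and a zero of `u` in the interior of that set would be a local minimum
of `u`, so `u > 0` on the interior of the support and the derivative does not vanish there.

The derivatives of `γ` and `expNegInvGlue` are bounded where they are used, and so is that of `T`
on the tube if the bump is Lipschitz; this gives the Lipschitz version.
-/

open Filter Topology

/-! ### Two smooth functions of a real variable -/

theorem hasDerivAt_expNegInvGlue (x : ℝ) :
    HasDerivAt expNegInvGlue ((x⁻¹) ^ 2 * expNegInvGlue x) x := by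
  simpa using expNegInvGlue.hasDerivAt_polynomial_eval_inv_mul 1 x

theorem expNegInvGlue_le_one (x : ℝ) : expNegInvGlue x ≤ 1 := by
  unfold expNegInvGlue
  split_ifs with h
  · exact zero_le_one
  · exact Real.exp_le_one_iff.2 (neg_nonpos.2 (inv_nonneg.2 (not_le.1 h).le))

theorem exists_abs_deriv_expNegInvGlue_le :
    ∃ G : ℝ, ∀ x ≤ 1, |deriv expNegInvGlue x| ≤ G := by
  have hc : Continuous (deriv expNegInvGlue) :=
    (expNegInvGlue.contDiff (n := 1)).continuous_deriv le_rfl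
  obtain ⟨G, hG⟩ := (isCompact_Icc (a := (0 : ℝ)) (b := 1)).exists_bound_of_continuousOn
    hc.continuousOn
  refine ⟨G, fun x hx => ?_⟩
  rcases le_total 0 x with h | h
  · exact hG x ⟨h, hx⟩
  · rw [(hasDerivAt_expNegInvGlue x).deriv, expNegInvGlue.zero_of_nonpos h, mul_zero, abs_zero]
    exact (norm_nonneg _).trans (hG 0 ⟨le_rfl, zero_le_one⟩)

theorem deriv_smoothTransition_of_nonpos {x : ℝ} (hx : x ≤ 0) :
    deriv Real.smoothTransition x = 0 := by
  refine IsLocalMin.deriv_eq_zero (Eventually.of_forall fun y => ?_)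
  rw [Real.smoothTransition.zero_of_nonpos hx]
  exact Real.smoothTransition.nonneg y

theorem deriv_smoothTransition_of_one_le {x : ℝ} (hx : 1 ≤ x) :
    deriv Real.smoothTransition x = 0 := by
  refine IsLocalMax.deriv_eq_zero (Eventually.of_forall fun y => ?_)
  rw [Real.smoothTransition.one_of_one_le hx]
  exact Real.smoothTransition.le_one y

theorem exists_abs_deriv_smoothTransition_le :
    ∃ H : ℝ, 0 ≤ H ∧ ∀ x, |deriv Real.smoothTransition x| ≤ H := by
  have hc : Continuous (deriv Real.smoothTransition) :=
    (Real.smoothTransition.contDiff (n := 1)).continuous_deriv le_rfl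
  obtain ⟨H, hH⟩ := (isCompact_Icc (a := (0 : ℝ)) (b := 1)).exists_bound_of_continuousOn
    hc.continuousOn
  have h0 : 0 ≤ H := (norm_nonneg _).trans (hH 0 ⟨le_rfl, zero_le_one⟩)
  refine ⟨H, h0, fun x => ?_⟩
  rcases le_total x 0 with h | h
  · rwa [deriv_smoothTransition_of_nonpos h, abs_zero]
  rcases le_total x 1 with h' | h'
  · exact hH x ⟨h, h'⟩
  · rwa [deriv_smoothTransition_of_one_le h', abs_zero]

theorem exists_lipschitzWith_smoothTransition : ∃ K, LipschitzWith K Real.smoothTransition := by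
  obtain ⟨H, h0, hH⟩ := exists_abs_deriv_smoothTransition_le
  refine ⟨⟨H, h0⟩, lipschitzWith_of_nnnorm_deriv_le
    ((Real.smoothTransition.contDiff (n := 1)).differentiable one_ne_zero) fun x => hH x⟩

/-! ### Locally finite sums -/

section LocallyFiniteSum

variable {E F : Type*} [NormedAddCommGroup E] [NormedSpace ℝ E]
  [NormedAddCommGroup F] [NormedSpace ℝ F]

theorem contDiff_tsum_of_locally_finite {n : WithTop ℕ∞} {φ : ℕ → E → F}
    (hφ : ∀ i, ContDiff ℝ n (φ i))
    (hf : ∀ x, ∃ J : Finset ℕ, ∀ᶠ y in 𝓝 x, ∀ j ∉ J, φ j y = 0) :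
    ContDiff ℝ n fun x => ∑' j, φ j x := by
  refine contDiff_iff_contDiffAt.2 fun x => ?_
  obtain ⟨J, hJ⟩ := hf x
  have h : ContDiffAt ℝ n (fun y => ∑ j ∈ J, φ j y) x :=
    (ContDiff.sum fun j _ => hφ j).contDiffAt
  exact h.congr_of_eventuallyEq (hJ.mono fun y hy => tsum_eq_sum hy)

end LocallyFiniteSum

/-! ### A bounded smooth path that stays away from its past -/

section Path

variable {X : Type*} [NormedAddCommGroup X] [NormedSpace ℝ X]

/-- The smooth path that runs from `v n` to `v (n + 1)` along a segment during the time interval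
`[n, n + 1]`, stopping at each vertex; for negative times it rests at `v 0`. -/
noncomputable def vertexPath (v : ℕ → X) (t : ℝ) : X :=
  v 0 + ∑' n : ℕ, Real.smoothTransition (t - n) • (v (n + 1) - v n)

theorem vertexPath_eq_sum (v : ℕ → X) {M : ℕ} {t : ℝ} (ht : t ≤ M) :
    vertexPath v t =
      v 0 + ∑ n ∈ Finset.range M, Real.smoothTransition (t - n) • (v (n + 1) - v n) := by
  rw [vertexPath, tsum_eq_sum]
  intro n hn
  have h : (M : ℝ) ≤ n := by exact_mod_cast not_lt.1 fun h => hn (Finset.mem_range.2 h)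
  rw [Real.smoothTransition.zero_of_nonpos (by linarith), zero_smul]

theorem vertexPath_eq_segment (v : ℕ → X) {m : ℕ} {t : ℝ} (h1 : m ≤ t) (h2 : t ≤ m + 1) :
    vertexPath v t = (1 - Real.smoothTransition (t - m)) • v m
      + Real.smoothTransition (t - m) • v (m + 1) := by
  rw [vertexPath_eq_sum v (M := m + 1) (by push_cast; exact h2), Finset.sum_range_succ]
  have h : ∑ n ∈ Finset.range m, Real.smoothTransition (t - n) • (v (n + 1) - v n)
      = v m - v 0 := by
    rw [← Finset.sum_range_sub v m]
    refine Finset.sum_congr rfl fun n hn => ?_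
    have h : (n : ℝ) + 1 ≤ m := by exact_mod_cast Finset.mem_range.1 hn
    rw [Real.smoothTransition.one_of_one_le (by linarith), one_smul]
  rw [h]
  module

theorem vertexPath_of_nonpos (v : ℕ → X) {t : ℝ} (ht : t ≤ 0) : vertexPath v t = v 0 := by
  rw [vertexPath_eq_sum v (M := 0) (by simpa using ht)]
  simp

theorem contDiff_vertexPath (v : ℕ → X) {n : ℕ∞} : ContDiff ℝ n (vertexPath v) := by
  refine contDiff_const.add (contDiff_tsum_of_locally_finite (fun i => ?_) fun t => ?_)
  · exact (Real.smoothTransition.contDiff.comp (contDiff_id.sub contDiff_const)).smul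
      contDiff_const
  · refine ⟨Finset.range (⌈t⌉₊ + 1), ?_⟩
    filter_upwards [Iio_mem_nhds (show t < ⌈t⌉₊ + 1 by linarith [Nat.le_ceil t])] with y hy n hn
    have h : ((⌈t⌉₊ + 1 : ℕ) : ℝ) ≤ n := by
      exact_mod_cast not_lt.1 fun h => hn (Finset.mem_range.2 h)
    push_cast at h
    rw [Real.smoothTransition.zero_of_nonpos (by linarith [Set.mem_Iio.1 hy]), zero_smul]

theorem norm_vertexPath_le {v : ℕ → X} (hv : ∀ n, ‖v n‖ ≤ 1) (t : ℝ) : ‖vertexPath v t‖ ≤ 1 := by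
  rcases le_total t 0 with h | h
  · rw [vertexPath_of_nonpos v h]; exact hv 0
  rw [vertexPath_eq_segment v (Nat.floor_le h) (Nat.lt_floor_add_one t).le]
  set a := Real.smoothTransition (t - ⌊t⌋₊)
  have h0 : 0 ≤ a := Real.smoothTransition.nonneg _
  have h1 : a ≤ 1 := Real.smoothTransition.le_one _
  refine (norm_add_le _ _).trans ?_
  rw [norm_smul, norm_smul, Real.norm_of_nonneg h0, Real.norm_of_nonneg (sub_nonneg.2 h1)]
  nlinarith [hv ⌊t⌋₊, hv (⌊t⌋₊ + 1)]

theorem exists_lipschitzWith_vertexPath :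
    ∃ K : NNReal, ∀ v : ℕ → X, (∀ n, ‖v n‖ ≤ 1) → LipschitzWith K (vertexPath v) := by
  obtain ⟨H, h0, hH⟩ := exists_abs_deriv_smoothTransition_le
  refine ⟨⟨H * 2, by positivity⟩, fun v hv => lipschitzWith_of_nnnorm_deriv_le
    ((contDiff_vertexPath v (n := 1)).differentiable one_ne_zero) fun t => ?_⟩
  have hM : t < (⌈t⌉₊ + 1 : ℕ) := by push_cast; linarith [Nat.le_ceil t]
  have hd : HasDerivAt (vertexPath v) (∑ n ∈ Finset.range (⌈t⌉₊ + 1),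
      deriv Real.smoothTransition (t - n) • (v (n + 1) - v n)) t := by
    have h : HasDerivAt (fun s : ℝ => v 0 + ∑ n ∈ Finset.range (⌈t⌉₊ + 1),
        Real.smoothTransition (s - n) • (v (n + 1) - v n)) (∑ n ∈ Finset.range (⌈t⌉₊ + 1),
        deriv Real.smoothTransition (t - n) • (v (n + 1) - v n)) t := by
      refine HasDerivAt.const_add _ (HasDerivAt.fun_sum fun n _ => ?_)
      have h1 : HasDerivAt Real.smoothTransition (deriv Real.smoothTransition (t - n)) (t - n) :=
        ((Real.smoothTransition.contDiff (n := 1)).differentiable one_ne_zero _).hasDerivAt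
      exact (h1.comp_sub_const t n).smul_const _
    refine h.congr_of_eventuallyEq ?_
    filter_upwards [Iio_mem_nhds hM] with s hs using vertexPath_eq_sum v (le_of_lt hs)
  change ‖deriv (vertexPath v) t‖ ≤ H * 2
  rw [hd.deriv]
  refine (norm_sum_le _ _).trans ?_
  -- Only the index `⌊t⌋₊` contributes: the derivative of the transition vanishes off `(0, 1)`.
  have hb : ∀ n ∈ Finset.range (⌈t⌉₊ + 1), ‖deriv Real.smoothTransition (t - n) •
      (v (n + 1) - v n)‖ ≤ if n = ⌊t⌋₊ then H * 2 else 0 := by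
    intro n _
    split_ifs with hn
    · rw [norm_smul]
      exact mul_le_mul (hH _) ((norm_sub_le _ _).trans (by linarith [hv n, hv (n + 1)]))
        (norm_nonneg _) h0
    · have : deriv Real.smoothTransition (t - n) = 0 := by
        rcases lt_or_ge t n with h | h
        · exact deriv_smoothTransition_of_nonpos (by linarith)
        · refine deriv_smoothTransition_of_one_le ?_
          have h1 : n ≤ ⌊t⌋₊ := Nat.le_floor h
          have h2 : n + 1 ≤ ⌊t⌋₊ := by omega
          have h3 : ((n + 1 : ℕ) : ℝ) ≤ t := (Nat.le_floor_iff' (by omega)).1 h2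
          push_cast at h3
          linarith
      rw [this, zero_smul, norm_zero]
  refine (Finset.sum_le_sum hb).trans ?_
  rw [Finset.sum_ite_eq']
  split_ifs
  · exact le_rfl
  · positivity

/-- If the vertices form a triangular system with functionals of norm at most one, the path keeps
distance `1 / 3` from its past: from time `s + 2` on it lies in the kernels of the two functionals
that belong to the segment containing `vertexPath v s`. -/
theorem one_third_le_norm_vertexPath_sub {v : ℕ → X} {φ : ℕ → X →L[ℝ] ℝ} (hφ : ∀ n, ‖φ n‖ ≤ 1)
    (hv : ∀ n, ‖v n‖ ≤ 1) (hdiag : ∀ n, φ n (v n) = 1) (htri : ∀ m n, m < n → φ m (v n) = 0)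
    {s t : ℝ} (hs : 0 ≤ s) (hst : s + 2 ≤ t) : 1 / 3 ≤ ‖vertexPath v t - vertexPath v s‖ := by
  have ht : 0 ≤ t := by linarith
  have hnm : ⌊s⌋₊ + 2 ≤ ⌊t⌋₊ := Nat.le_floor (by push_cast; linarith [Nat.floor_le hs])
  have hle : ∀ n, |φ n (vertexPath v t - vertexPath v s)| ≤ ‖vertexPath v t - vertexPath v s‖ :=
    fun n => ((φ n).le_opNorm _).trans (mul_le_of_le_one_left (norm_nonneg _) (hφ n))
  have h1 := hle ⌊s⌋₊
  have h2 := hle (⌊s⌋₊ + 1)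
  have hlow : |φ (⌊s⌋₊ + 1) (v ⌊s⌋₊)| ≤ 1 :=
    ((φ _).le_opNorm _).trans (mul_le_one₀ (hφ _) (norm_nonneg _) (hv _))
  rw [vertexPath_eq_segment v (Nat.floor_le hs) (Nat.lt_floor_add_one s).le,
    vertexPath_eq_segment v (Nat.floor_le ht) (Nat.lt_floor_add_one t).le] at h1 h2 ⊢
  set a := Real.smoothTransition (s - ⌊s⌋₊)
  have ha0 : 0 ≤ a := Real.smoothTransition.nonneg _
  have ha1 : a ≤ 1 := Real.smoothTransition.le_one _
  simp only [map_sub, map_add, map_smul, smul_eq_mul, hdiag,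
    htri ⌊s⌋₊ ⌊t⌋₊ (by omega), htri ⌊s⌋₊ (⌊t⌋₊ + 1) (by omega), htri ⌊s⌋₊ (⌊s⌋₊ + 1) (by omega),
    htri (⌊s⌋₊ + 1) ⌊t⌋₊ (by omega), htri (⌊s⌋₊ + 1) (⌊t⌋₊ + 1) (by omega)] at h1 h2
  have h1' := (neg_le_abs _).trans h1
  have h2' := (neg_le_abs _).trans h2
  have h3 : -(1 - a) ≤ (1 - a) * φ (⌊s⌋₊ + 1) (v ⌊s⌋₊) := by
    nlinarith [(abs_le.1 hlow).1]
  -- The two functionals give the lower bounds `1 - a` and `2 * a - 1`, of which the larger one is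
  -- at least `1 / 3`.
  linarith

theorem exists_unit_vector_of_finset (hX : ¬ FiniteDimensional ℝ X) (s : Finset (X →L[ℝ] ℝ)) :
    ∃ x : X, ‖x‖ = 1 ∧ ∀ φ ∈ s, φ x = 0 := by
  let T : X →ₗ[ℝ] (s → ℝ) := LinearMap.pi fun φ => (φ.1 : X →ₗ[ℝ] ℝ)
  have hT : ¬ Function.Injective T := fun h => hX (FiniteDimensional.of_injective T h)
  rw [← LinearMap.ker_eq_bot, Submodule.eq_bot_iff] at hT
  push Not at hT
  obtain ⟨x, hx, hx0⟩ := hT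
  refine ⟨‖x‖⁻¹ • x, norm_smul_inv_norm (𝕜 := ℝ) hx0, fun φ hφ => ?_⟩
  have : φ x = 0 := congrFun (LinearMap.mem_ker.1 hx) ⟨φ, hφ⟩
  rw [map_smul, this, smul_zero]

/-- Each `v n` is a unit vector in the common kernel of the earlier functionals, and `φ n` norms
it. -/
theorem exists_triangular_sequence (hX : ¬ FiniteDimensional ℝ X) :
    ∃ (v : ℕ → X) (φ : ℕ → X →L[ℝ] ℝ), (∀ n, ‖v n‖ ≤ 1) ∧ (∀ n, ‖φ n‖ ≤ 1) ∧
      (∀ n, φ n (v n) = 1) ∧ ∀ m n, m < n → φ m (v n) = 0 := by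
  classical
  obtain ⟨f, hf, hr⟩ := exists_seq_of_forall_finset_exists
    (fun z : X × (X →L[ℝ] ℝ) => ‖z.1‖ ≤ 1 ∧ ‖z.2‖ ≤ 1 ∧ z.2 z.1 = 1)
    (fun z w => z.2 w.1 = 0) (fun s _ => by
      obtain ⟨x, hx, hs⟩ := exists_unit_vector_of_finset hX (s.image Prod.snd)
      obtain ⟨φ, hφ, hφx⟩ := exists_dual_vector ℝ x (by rw [hx]; exact one_ne_zero)
      refine ⟨(x, φ), ⟨hx.le, hφ.le, ?_⟩, fun z hz => hs _ (Finset.mem_image_of_mem _ hz)⟩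
      simpa [hx] using hφx)
  exact ⟨fun n => (f n).1, fun n => (f n).2, fun n => (hf n).1, fun n => (hf n).2.1,
    fun n => (hf n).2.2, fun m n h => hr m n h⟩

/-- The path runs in a hyperplane `ker l`, is bounded, moves as slowly as desired, and keeps
distance `1 / 3` between positions at times that differ by at least `C`. -/
theorem exists_slow_separated_path (hX : ¬ FiniteDimensional ℝ X) {η : ℝ} (hη : 0 < η) :
    ∃ (e : X) (l : X →L[ℝ] ℝ) (γ : ℝ → X) (C : ℝ), l e = 1 ∧ (∀ t, l (γ t) = 0) ∧
      (∀ n : ℕ∞, ContDiff ℝ n γ) ∧ (∀ t, ‖γ t‖ ≤ 1) ∧ (∀ s t, ‖γ s - γ t‖ ≤ η * |s - t|) ∧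
      ∀ s t, 0 ≤ s → 0 ≤ t → C ≤ |s - t| → 1 / 3 ≤ ‖γ s - γ t‖ := by
  obtain ⟨v, φ, hv, hφ, hdiag, htri⟩ := exists_triangular_sequence hX
  obtain ⟨K, hK⟩ := exists_lipschitzWith_vertexPath (X := X)
  have hv' : ∀ n, ‖v (n + 1)‖ ≤ 1 := fun n => hv _
  set Γ := vertexPath fun n => v (n + 1) with hΓ
  have hsep : ∀ s t : ℝ, 0 ≤ s → s + 2 ≤ t → 1 / 3 ≤ ‖Γ t - Γ s‖ := fun s t hs hst =>
    one_third_le_norm_vertexPath_sub (fun n => hφ (n + 1)) hv' (fun n => hdiag _)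
      (fun m n h => htri _ _ (by omega)) hs hst
  obtain ⟨a, ha, haη⟩ : ∃ a : ℝ, 0 < a ∧ K * a ≤ η := by
    refine ⟨η / (K + 1), by positivity, ?_⟩
    rw [← mul_div_assoc, div_le_iff₀ (by positivity)]
    nlinarith [K.2]
  refine ⟨v 0, φ 0, fun t => Γ (a * t), 2 / a, hdiag 0, fun t => ?_, fun n => ?_, fun t =>
    norm_vertexPath_le hv' _, fun s t => ?_, fun s t hs ht h => ?_⟩
  · change φ 0 (Γ (a * t)) = 0
    generalize a * t = t
    rcases le_total t 0 with h | h
    · rw [hΓ, vertexPath_of_nonpos _ h, htri _ _ (by omega)]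
    · rw [hΓ, vertexPath_eq_segment _ (Nat.floor_le h) (Nat.lt_floor_add_one t).le]
      simp [htri 0 (⌊t⌋₊ + 1) (by omega), htri 0 (⌊t⌋₊ + 1 + 1) (by omega)]
  · exact (contDiff_vertexPath _).comp (contDiff_const.mul contDiff_id)
  · have h := (hK _ hv').dist_le_mul (a * s) (a * t)
    rw [dist_eq_norm, Real.dist_eq, ← mul_sub, abs_mul, abs_of_pos ha, ← mul_assoc] at h
    refine h.trans ?_
    exact mul_le_mul_of_nonneg_right haη (abs_nonneg _)
  · rw [div_le_iff₀ ha] at h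
    rcases le_total s t with hst | hst
    · rw [norm_sub_rev]
      rw [abs_of_nonpos (by linarith)] at h
      exact hsep _ _ (by positivity) (by linarith)
    · rw [abs_of_nonneg (by linarith)] at h
      exact hsep _ _ (by positivity) (by linarith)

end Path

/-! ### Plateau functions and the clock of a path -/

section Clock

variable {X : Type*} [NormedAddCommGroup X] [NormedSpace ℝ X]

/-- A bump function can be recentred, rescaled and cut off to equal `1` on a ball around `0` and
`0` off the unit ball. -/
theorem IsBump.exists_plateau {p : ℕ∞} {b : X → ℝ} (hb : IsBump b) (hp : ContDiff ℝ p b) :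
    ∃ (χ : X → ℝ) (r : ℝ), 0 < r ∧ r ≤ 1 ∧ ContDiff ℝ p χ ∧ (∀ x, 0 ≤ χ x) ∧ (∀ x, χ x ≤ 1) ∧
      (∀ x, ‖x‖ ≤ r → χ x = 1) ∧ (∀ x, 1 ≤ ‖x‖ → χ x = 0) ∧
      ((∃ K, LipschitzWith K b) → ∃ K, LipschitzWith K χ) := by
  obtain ⟨⟨x₀, hx₀⟩, hbd⟩ := hb
  obtain ⟨R₀, hR₀⟩ := hbd.exists_norm_le
  have hvan : ∀ x, R₀ < ‖x‖ → b x = 0 := fun x hx => by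
    by_contra h
    exact absurd (hR₀ x (subset_tsupport b h)) (not_le.2 hx)
  have hR₀' : 0 ≤ R₀ := (norm_nonneg _).trans (hR₀ x₀ (subset_tsupport b hx₀))
  set R := R₀ + ‖x₀‖ + 1 with hR
  have hRpos : 0 < R := by positivity
  set g : X → ℝ := fun x => 2 * ((b x₀)⁻¹ * b (x₀ + R • x)) with hg
  have hgp : ContDiff ℝ p g :=
    contDiff_const.mul (contDiff_const.mul
      (hp.comp (contDiff_const.add (contDiff_id.const_smul R))))
  have hg0 : g 0 = 2 := by simp [hg, hx₀]
  obtain ⟨r, hr, hrg⟩ := Metric.eventually_nhds_iff_ball.1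
    (hgp.continuous.continuousAt.eventually (lt_mem_nhds (show (1 : ℝ) < g 0 by norm_num [hg0])))
  refine ⟨fun x => Real.smoothTransition (g x), min (r / 2) 1, by positivity, min_le_right _ _,
    Real.smoothTransition.contDiff.comp hgp, fun x => Real.smoothTransition.nonneg _,
    fun x => Real.smoothTransition.le_one _, fun x hx => ?_, fun x hx => ?_, ?_⟩
  · refine Real.smoothTransition.one_of_one_le (hrg x ?_).le
    rw [mem_ball_zero_iff]
    linarith [hx.trans (min_le_left _ _)]
  · have h : R₀ < ‖x₀ + R • x‖ := by
      have h1 : ‖R • x‖ ≤ ‖x₀ + R • x‖ + ‖x₀‖ := by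
        simpa using norm_sub_le (x₀ + R • x) x₀
      rw [norm_smul, Real.norm_of_nonneg hRpos.le] at h1
      nlinarith
    simp [hg, hvan _ h]
  · rintro ⟨K, hK⟩
    obtain ⟨H, hH⟩ := exists_lipschitzWith_smoothTransition
    refine ⟨H * (‖(2 : ℝ) * (b x₀)⁻¹‖₊ * (K * ‖R‖₊)), hH.comp ?_⟩
    have h1 : LipschitzWith (K * ‖R‖₊) fun x => b (x₀ + R • x) := by
      refine hK.comp (LipschitzWith.of_dist_le_mul fun x y => ?_)
      rw [dist_add_left, dist_smul₀, coe_nnnorm]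
    refine LipschitzWith.of_dist_le_mul fun x y => ?_
    have h2 := h1.dist_le_mul x y
    rw [Real.dist_eq] at h2 ⊢
    have h3 : g x - g y = (2 * (b x₀)⁻¹) * (b (x₀ + R • x) - b (x₀ + R • y)) := by
      simp only [hg]; ring
    rw [h3, abs_mul, NNReal.coe_mul, mul_assoc, coe_nnnorm, Real.norm_eq_abs]
    exact mul_le_mul_of_nonneg_left h2 (abs_nonneg _)

/-- A function that tells the time along a self-avoiding path `γ`, up to a bounded error and on a
whole tube around `γ`. It is the average of the integers `j`, weighted by plateau functions of
radius `1 / 12` centred at `γ j`; these centres are dense enough along `γ` to cover the tube of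
radius `r / 24`, and by separation only those with `j` close to `s` are active near `γ s`. -/
theorem exists_clock {p : ℕ∞} (hp : 1 ≤ p) {χ : X → ℝ} {r : ℝ} (hr0 : 0 < r) (hr1 : r ≤ 1)
    (hχ : ContDiff ℝ p χ) (hχ0 : ∀ x, 0 ≤ χ x) (hone : ∀ x, ‖x‖ ≤ r → χ x = 1)
    (hzero : ∀ x, 1 ≤ ‖x‖ → χ x = 0) {γ : ℝ → X} {C : ℝ}
    (hγ : ∀ s t, ‖γ s - γ t‖ ≤ r / 24 * |s - t|)
    (hsep : ∀ s t, 0 ≤ s → 0 ≤ t → C ≤ |s - t| → 1 / 3 ≤ ‖γ s - γ t‖) :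
    ∃ T : X → ℝ, ContDiff ℝ p T ∧
      (∀ s, 0 ≤ s → ∀ w, ‖w - γ s‖ < r / 24 → |T w - s| ≤ C) ∧
      ((∃ K, LipschitzWith K χ) →
        ∃ K, ∀ s, 0 ≤ s → ∀ w, ‖w - γ s‖ < r / 24 → ‖fderiv ℝ T w‖ ≤ K) := by
  set ω : ℕ → X → ℝ := fun j w => χ ((12 : ℝ) • (w - γ j)) with hω
  have hωp : ∀ j, ContDiff ℝ p (ω j) := fun j =>
    hχ.comp ((contDiff_id.sub contDiff_const).const_smul (12 : ℝ))
  have hω0 : ∀ j w, 0 ≤ ω j w := fun j w => hχ0 _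
  have hnorm : ∀ j w, ‖(12 : ℝ) • (w - γ j)‖ = 12 * ‖w - γ j‖ := fun j w => by
    rw [norm_smul]; norm_num
  have hact : ∀ j w, ω j w ≠ 0 → ‖w - γ j‖ < 1 / 12 := fun j w h => by
    by_contra h'
    exact h (hzero _ (by rw [hnorm]; linarith [not_lt.1 h']))
  have hclose : ∀ s t, 0 ≤ s → 0 ≤ t → ‖γ s - γ t‖ < 1 / 3 → |s - t| < C := fun s t hs ht h => by
    by_contra h'
    exact absurd (hsep s t hs ht (not_lt.1 h')) (not_le.2 h)
  have hfin : ∀ w, ∃ J : Finset ℕ, ∀ᶠ y in 𝓝 w, ∀ j ∉ J, ω j y = 0 := by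
    intro w
    by_cases hne : ∃ i, ∃ y ∈ Metric.ball w (1 / 12), ω i y ≠ 0
    · obtain ⟨i, y, hy, hi⟩ := hne
      refine ⟨Finset.range (⌈(i : ℝ) + C⌉₊ + 1), ?_⟩
      filter_upwards [Metric.ball_mem_nhds w (show (0 : ℝ) < 1 / 12 by norm_num)] with z hz j hj
      by_contra h
      have h1 := hact _ _ hi
      have h2 := hact _ _ h
      have h3 : ‖γ j - γ i‖ < 1 / 3 := by
        have e : γ j - γ i = -(z - γ j) + (z - w) + -(y - w) + (y - γ i) := by abel
        rw [Metric.mem_ball, dist_eq_norm] at hy hz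
        rw [e]
        refine (norm_add₄_le).trans_lt ?_
        rw [norm_neg, norm_neg]
        linarith
      have h4 := (abs_lt.1 (hclose _ _ (Nat.cast_nonneg _) (Nat.cast_nonneg _) h3)).2
      refine hj (Finset.mem_range.2 (Nat.lt_succ_of_le ?_))
      exact_mod_cast (show (j : ℝ) ≤ ⌈(i : ℝ) + C⌉₊ by linarith [Nat.le_ceil ((i : ℝ) + C)])
    · push Not at hne
      refine ⟨∅, ?_⟩
      filter_upwards [Metric.ball_mem_nhds w (show (0 : ℝ) < 1 / 12 by norm_num)] with z hz j _
      exact hne j z hz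
  set D : X → ℝ := fun w => ∑' j, ω j w with hD
  set A : X → ℝ := fun w => ∑' j : ℕ, (j : ℝ) * ω j w with hA
  have hDp : ContDiff ℝ p D := contDiff_tsum_of_locally_finite hωp hfin
  have hAp : ContDiff ℝ p A := by
    refine contDiff_tsum_of_locally_finite (fun j => contDiff_const.mul (hωp j)) fun w => ?_
    obtain ⟨J, hJ⟩ := hfin w
    exact ⟨J, hJ.mono fun y hy j hj => by rw [hy j hj, mul_zero]⟩
  have hD0 : ∀ w, 0 ≤ D w := fun w => tsum_nonneg fun j => hω0 j w
  -- The correction term vanishes where `D ≥ 1` and keeps the denominator positive elsewhere.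
  have hpos : ∀ w, 0 < D w + expNegInvGlue (1 - D w) := fun w => by
    rcases lt_or_ge (D w) 1 with h | h
    · exact add_pos_of_nonneg_of_pos (hD0 w) (expNegInvGlue.pos_of_pos (by linarith))
    · exact add_pos_of_pos_of_nonneg (by linarith) (expNegInvGlue.nonneg _)
  have hTp : ContDiff ℝ p fun w => A w / (D w + expNegInvGlue (1 - D w)) :=
    hAp.div (hDp.add (expNegInvGlue.contDiff.comp (contDiff_const.sub hDp)))
      fun w => (hpos w).ne'
  -- Near a point of the tube at time `s`, only the centres with times in `[s - C, s + C]` matter.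
  have hloc : ∀ s, 0 ≤ s → ∀ w, ‖w - γ s‖ < r / 24 → ∀ᶠ y in 𝓝 w,
      ∀ j ∉ Finset.Icc ⌈s - C⌉₊ ⌊s + C⌋₊, ω j y = 0 := by
    intro s hs w hw
    filter_upwards [Metric.ball_mem_nhds w (show (0 : ℝ) < 1 / 12 by norm_num)] with y hy j hj
    by_contra h
    have h1 := hact _ _ h
    have h3 : ‖γ j - γ s‖ < 1 / 3 := by
      have e : γ j - γ s = -(y - γ j) + (y - w) + (w - γ s) := by abel
      rw [Metric.mem_ball, dist_eq_norm] at hy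
      rw [e]
      refine (norm_add₃_le).trans_lt ?_
      rw [norm_neg]
      linarith
    have h4 := abs_lt.1 (hclose _ _ (Nat.cast_nonneg _) hs h3)
    exact hj (Finset.mem_Icc.2 ⟨Nat.ceil_le.2 (by linarith), Nat.le_floor (by linarith)⟩)
  have hD1 : ∀ s, 0 ≤ s → ∀ w, ‖w - γ s‖ < r / 24 → 1 ≤ D w := by
    intro s hs w hw
    have h1 : ω ⌊s⌋₊ w = 1 := by
      refine hone _ ?_
      have h2 := hγ s ⌊s⌋₊
      have h3 : |s - ⌊s⌋₊| ≤ 1 := by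
        rw [abs_le]; constructor <;> linarith [Nat.floor_le hs, Nat.lt_floor_add_one s]
      have h4 : ‖w - γ ⌊s⌋₊‖ ≤ ‖w - γ s‖ + ‖γ s - γ ⌊s⌋₊‖ :=
        norm_sub_le_norm_sub_add_norm_sub _ _ _
      rw [hnorm]
      nlinarith
    rw [← h1]
    exact (summable_of_hasFiniteSupport ((Finset.finite_toSet _).subset fun j hj => by
      by_contra hj'; exact hj ((hloc s hs w hw).self_of_nhds j hj'))).le_tsum _ fun j _ => hω0 j w
  have hmul : ∀ s, 0 ≤ s → ∀ w, ‖w - γ s‖ < r / 24 →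
      A w / (D w + expNegInvGlue (1 - D w)) * D w = A w := by
    intro s hs w hw
    have h := hD1 s hs w hw
    rw [expNegInvGlue.zero_of_nonpos (by linarith), add_zero, div_mul_cancel₀ _ (by linarith)]
  set T : X → ℝ := fun w => A w / (D w + expNegInvGlue (1 - D w)) with hT
  have hbound : ∀ s, 0 ≤ s → ∀ w, ‖w - γ s‖ < r / 24 → |T w - s| ≤ C := by
    intro s hs w hw
    have h1 := hD1 s hs w hw
    have h2 := (hloc s hs w hw).self_of_nhds
    have hDs : D w = ∑ j ∈ Finset.Icc ⌈s - C⌉₊ ⌊s + C⌋₊, ω j w := tsum_eq_sum h2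
    have hAs : A w = ∑ j ∈ Finset.Icc ⌈s - C⌉₊ ⌊s + C⌋₊, (j : ℝ) * ω j w :=
      tsum_eq_sum fun j hj => by rw [h2 j hj, mul_zero]
    have h3 : (T w - s) * D w = ∑ j ∈ Finset.Icc ⌈s - C⌉₊ ⌊s + C⌋₊, ((j : ℝ) - s) * ω j w := by
      rw [sub_mul, hmul s hs w hw, hAs, hDs, Finset.mul_sum, ← Finset.sum_sub_distrib]
      exact Finset.sum_congr rfl fun j _ => by ring
    have h4 : |(T w - s) * D w| ≤ C * D w := by
      rw [h3, hDs, Finset.mul_sum]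
      refine (Finset.abs_sum_le_sum_abs _ _).trans (Finset.sum_le_sum fun j hj => ?_)
      rw [abs_mul, abs_of_nonneg (hω0 j w)]
      refine mul_le_mul_of_nonneg_right ?_ (hω0 j w)
      obtain ⟨h5, h6⟩ := Finset.mem_Icc.1 hj
      have hC : 0 < C := by simpa using hclose s s hs hs (by simp)
      rw [abs_le]
      constructor <;> linarith [Nat.ceil_le.1 h5, (Nat.le_floor_iff (by linarith)).1 h6]
    rw [abs_mul, abs_of_nonneg (hD0 w)] at h4
    exact le_of_mul_le_mul_right h4 (by linarith)
  refine ⟨T, hTp, hbound, ?_⟩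
  rintro ⟨K, hK⟩
  have hωK : ∀ j w, ‖fderiv ℝ (ω j) w‖ ≤ K * 12 := by
    intro j w
    have h : LipschitzWith (K * 12) (ω j) := by
      refine hK.comp (LipschitzWith.of_dist_le_mul fun x y => ?_)
      rw [dist_smul₀, dist_sub_right]
      norm_num
    simpa using norm_fderiv_le_of_lipschitz ℝ h (x₀ := w)
  have hp1 : (p : WithTop ℕ∞) ≠ 0 := by
    simpa using (zero_lt_one.trans_le hp).ne'
  refine ⟨(2 * C + 1) * ((2 * C) * (K * 12)), fun s hs w hw => ?_⟩
  have hC : 0 < C := by simpa using hclose s s hs hs (by simp)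
  have h1 := hD1 s hs w hw
  set J := Finset.Icc ⌈s - C⌉₊ ⌊s + C⌋₊ with hJ
  have hJs : ∀ j ∈ J, |(j : ℝ) - s| ≤ C := fun j hj => by
    obtain ⟨h5, h6⟩ := Finset.mem_Icc.1 hj
    rw [abs_le]
    constructor <;> linarith [Nat.ceil_le.1 h5, (Nat.le_floor_iff (by linarith)).1 h6]
  have hJcard : (J.card : ℝ) ≤ 2 * C + 1 := by
    rw [hJ, Nat.card_Icc]
    rcases le_total ⌈s - C⌉₊ (⌊s + C⌋₊ + 1) with h | h
    · rw [Nat.cast_sub h]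
      push_cast
      linarith [Nat.le_ceil (s - C), Nat.floor_le (show 0 ≤ s + C by linarith)]
    · rw [Nat.sub_eq_zero_of_le h]
      push_cast
      linarith
  have hωd : ∀ j, HasFDerivAt (ω j) (fderiv ℝ (ω j) w) w := fun j =>
    ((hωp j).differentiable hp1 w).hasFDerivAt
  have hTd : HasFDerivAt T (fderiv ℝ T w) w := (hTp.differentiable hp1 w).hasFDerivAt
  have hDd : HasFDerivAt D (∑ j ∈ J, fderiv ℝ (ω j) w) w :=
    (HasFDerivAt.fun_sum fun j _ => hωd j).congr_of_eventuallyEq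
      ((hloc s hs w hw).mono fun y hy => tsum_eq_sum hy)
  have hAd : HasFDerivAt A (∑ j ∈ J, (j : ℝ) • fderiv ℝ (ω j) w) w :=
    (HasFDerivAt.fun_sum fun j _ => (hωd j).const_mul (j : ℝ)).congr_of_eventuallyEq
      ((hloc s hs w hw).mono fun y hy => tsum_eq_sum fun j hj => by rw [hy j hj, mul_zero])
  have htube : ∀ᶠ y in 𝓝 w, ‖y - γ s‖ < r / 24 :=
    (by fun_prop : Continuous fun y : X => ‖y - γ s‖).continuousAt.eventually (gt_mem_nhds hw)
  -- Differentiating `T * D = A` bounds `fderiv T` by finitely many terms near time `s`.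
  have heq := ((hTd.mul hDd).congr_of_eventuallyEq
    (htube.mono fun y hy => (hmul s hs y hy).symm)).unique hAd
  have h2 : D w • fderiv ℝ T w = ∑ j ∈ J, ((j : ℝ) - T w) • fderiv ℝ (ω j) w := by
    simp only [sub_smul, Finset.sum_sub_distrib, ← heq, ← Finset.smul_sum]
    abel
  have h3 : ‖D w • fderiv ℝ T w‖ ≤ (2 * C + 1) * ((2 * C) * (K * 12)) := by
    rw [h2]
    refine (norm_sum_le_of_le _ fun j hj => (?_ : _ ≤ (2 * C) * (K * 12))).trans ?_
    · rw [norm_smul, Real.norm_eq_abs]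
      refine mul_le_mul ?_ (hωK j w) (norm_nonneg _) (by positivity)
      have h5 : |(j : ℝ) - T w| ≤ |(j : ℝ) - s| + |s - T w| := abs_sub_le _ _ _
      rw [abs_sub_comm s] at h5
      linarith [hJs j hj, hbound s hs w hw]
    · rw [Finset.sum_const, nsmul_eq_mul]
      exact mul_le_mul_of_nonneg_right hJcard (by positivity)
  rw [norm_smul, Real.norm_of_nonneg (hD0 w)] at h3
  nlinarith [norm_nonneg (fderiv ℝ T w)]

end Clock

/-! ### The critical-point-free function and the bump -/

section Tube

variable {X : Type*} [NormedAddCommGroup X] [NormedSpace ℝ X]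

/-- The function `u` grows along the folded tube. It is normalized by `u ≤ 1`, and if the bump is
Lipschitz, its derivative is bounded on `{u > 0}`. -/
theorem exists_critical_point_free (hX : ¬ FiniteDimensional ℝ X) {p : ℕ∞} (hp : 1 ≤ p)
    {b : X → ℝ} (hb : IsBump b) (hbp : ContDiff ℝ p b) :
    ∃ u : X → ℝ, ContDiff ℝ p u ∧ (∀ x, fderiv ℝ u x ≠ 0) ∧ Bornology.IsBounded {x | 0 ≤ u x} ∧
      (∃ x, 0 < u x) ∧ (∀ x, u x ≤ 1) ∧
      ((∃ K, LipschitzWith K b) → ∃ K, ∀ x, 0 < u x → ‖fderiv ℝ u x‖ ≤ K) := by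
  have hp1 : (p : WithTop ℕ∞) ≠ 0 := by simpa using (zero_lt_one.trans_le hp).ne'
  obtain ⟨χ, r, hr0, hr1, hχ, hχ0, hχ1, hone, hzero, hχL⟩ := hb.exists_plateau hbp
  obtain ⟨e, l, γ, C, hle, hlγ, hγ, hγ1, hγL, hsep⟩ :=
    exists_slow_separated_path hX (show 0 < r / 24 by positivity)
  obtain ⟨T, hT, hTB, hTL⟩ := exists_clock hp hr0 hr1 hχ hχ0 hone hzero hγL hsep
  set P : X →L[ℝ] X := ContinuousLinearMap.id ℝ X - l.smulRight e with hP
  have hPx : ∀ x, P x = x - l x • e := fun x => by simp [hP]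
  set S : X → ℝ := fun x => l x + T (P x) with hS
  have hSp : ContDiff ℝ p S := l.contDiff.add (hT.comp P.contDiff)
  set u : X → ℝ := fun x => χ ((r / 24)⁻¹ • (P x - γ (S x))) - 2 * Real.exp (-S x) with hu
  have hup : ContDiff ℝ p u :=
    (hχ.comp ((P.contDiff.sub ((hγ p).comp hSp)).const_smul _)).sub
      (contDiff_const.mul (Real.contDiff_exp.comp hSp.neg))
  -- Coordinates: `w + (s - T w) • e` with `l w = 0` has height `s` and transversal part `w`.
  have hcoord : ∀ w s, l w = 0 → P (w + (s - T w) • e) = w ∧ S (w + (s - T w) • e) = s := by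
    intro w s hw
    have h1 : P (w + (s - T w) • e) = w := by simp [hPx, hw, hle]
    exact ⟨h1, by simp [hS, h1, hw, hle]⟩
  have hlP : ∀ x, l (P x) = 0 := fun x => by simp [hPx, hle]
  have htube : ∀ x, 0 ≤ u x → 0 ≤ S x ∧ ‖P x - γ (S x)‖ < r / 24 := by
    intro x hx
    have h1 : 2 * Real.exp (-S x) ≤ χ ((r / 24)⁻¹ • (P x - γ (S x))) := sub_nonneg.1 hx
    have h2 := Real.exp_pos (-S x)
    constructor
    · have h3 : Real.exp (-S x) ≤ 1 := by linarith [hχ1 ((r / 24)⁻¹ • (P x - γ (S x)))]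
      linarith [Real.exp_le_one_iff.1 h3]
    · by_contra h
      have h3 : χ ((r / 24)⁻¹ • (P x - γ (S x))) = 0 := by
        refine hzero _ ?_
        rw [norm_smul, norm_inv, Real.norm_of_nonneg (by positivity)]
        rw [← div_eq_inv_mul, le_div_iff₀ (by positivity), one_mul]
        exact not_lt.1 h
      linarith
  refine ⟨u, hup, fun x hx => ?_, ?_, ?_, fun x => ?_, ?_⟩
  · -- Following the path at fixed transversal offset, `u` increases at rate `2 * exp (-s)`.
    set w : ℝ → X := fun τ => P x - γ (S x) + γ τ with hw
    set c : ℝ → X := fun τ => w τ + (τ - T (w τ)) • e with hc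
    have hlw : ∀ τ, l (w τ) = 0 := fun τ => by simp [hw, hlP, hlγ]
    have hcx : c (S x) = x := by
      simp only [hc, hw, sub_add_cancel, hS, add_sub_cancel_right, hPx]
    have hwd : Differentiable ℝ w :=
      ((hγ 1).differentiable one_ne_zero).const_add _
    have hcd : Differentiable ℝ c :=
      hwd.add ((differentiable_id.sub ((hT.differentiable hp1).comp hwd)).smul_const e)
    have huc : ∀ τ, u (c τ) = χ ((r / 24)⁻¹ • (P x - γ (S x))) - 2 * Real.exp (-τ) := by
      intro τ
      obtain ⟨h1, h2⟩ := hcoord (w τ) τ (hlw τ)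
      simp only [hu, hc, h1, h2]
      simp only [hw, add_sub_cancel_right]
    have hd1 : HasDerivAt (fun τ => u (c τ)) 0 (S x) := by
      have h := (hup.differentiable hp1 (c (S x))).hasFDerivAt.comp_hasDerivAt (S x)
        (hcd (S x)).hasDerivAt
      rw [hcx, hx, zero_apply] at h
      exact h
    have hd2 : HasDerivAt (fun τ => u (c τ)) (2 * Real.exp (-S x)) (S x) := by
      simp only [huc]
      have h := (((hasDerivAt_neg (S x)).exp.const_mul 2).const_sub
        (χ ((r / 24)⁻¹ • (P x - γ (S x)))))
      exact h.congr_deriv (by ring)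
    have := hd1.unique hd2
    linarith [Real.exp_pos (-S x)]
  · refine (isBounded_iff_forall_norm_le).2 ⟨2 + C * ‖e‖, fun x hx => ?_⟩
    obtain ⟨h1, h2⟩ := htube x hx
    have h3 := hTB _ h1 _ h2
    have h4 : |l x| ≤ C := by
      rw [abs_sub_comm] at h3
      simpa [hS] using h3
    have h5 : x = (P x - γ (S x)) + γ (S x) + l x • e := by rw [hPx]; abel
    rw [h5]
    refine (norm_add₃_le).trans ?_
    rw [norm_smul, Real.norm_eq_abs]
    have h6 := mul_le_mul_of_nonneg_right h4 (norm_nonneg e)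
    linarith [hγ1 (S x)]
  · obtain ⟨h1, h2⟩ := hcoord (γ 2) 2 (hlγ 2)
    refine ⟨γ 2 + (2 - T (γ 2)) • e, ?_⟩
    have h3 : Real.exp (-2) < 1 / 2 := by
      rw [Real.exp_neg, inv_eq_one_div]
      exact one_div_lt_one_div_of_lt (by norm_num) (by linarith [Real.add_one_le_exp (2 : ℝ)])
    simp only [hu, h1, h2, sub_self, smul_zero]
    rw [hone 0 (by simpa using hr0.le)]
    linarith
  · have := Real.exp_pos (-S x)
    simp only [hu]
    linarith [hχ1 ((r / 24)⁻¹ • (P x - γ (S x)))]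
  · intro hL
    obtain ⟨K, hK⟩ := hχL hL
    obtain ⟨K', hK'⟩ := hTL ⟨K, hK⟩
    refine ⟨K * ((r / 24)⁻¹ * (‖P‖ + (‖l‖ + K' * ‖P‖) * (r / 24)))
      + 1 * (‖l‖ + K' * ‖P‖), fun x hx => ?_⟩
    obtain ⟨h1, h2⟩ := htube x hx.le
    have hSd : HasFDerivAt S (l + (fderiv ℝ T (P x)).comp P) x :=
      l.hasFDerivAt.add ((hT.differentiable hp1 (P x)).hasFDerivAt.comp x P.hasFDerivAt)
    set S' := l + (fderiv ℝ T (P x)).comp P with hS'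
    have hS'n : ‖S'‖ ≤ ‖l‖ + K' * ‖P‖ := by
      refine (norm_add_le _ _).trans (add_le_add le_rfl ?_)
      exact (ContinuousLinearMap.opNorm_comp_le _ _).trans
        (mul_le_mul_of_nonneg_right (hK' _ h1 _ h2) (norm_nonneg _))
    have hγd : HasDerivAt γ (deriv γ (S x)) (S x) :=
      ((hγ 1).differentiable one_ne_zero _).hasDerivAt
    have hγn : ‖deriv γ (S x)‖ ≤ r / 24 := by
      have h : LipschitzWith ⟨r / 24, by positivity⟩ γ :=
        LipschitzWith.of_dist_le_mul fun s t => by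
          rw [dist_eq_norm, Real.dist_eq]; exact hγL s t
      exact norm_deriv_le_of_lipschitz h
    set y := (r / 24)⁻¹ • (P x - γ (S x)) with hy
    have hχn : ‖fderiv ℝ χ y‖ ≤ K := norm_fderiv_le_of_lipschitz ℝ hK
    have hud := ((hχ.differentiable hp1 y).hasFDerivAt.comp x
      ((P.hasFDerivAt.sub (hγd.hasFDerivAt.comp x hSd)).const_smul ((r / 24)⁻¹))).sub
      ((hSd.neg.exp).const_mul 2)
    have hexp : 2 * Real.exp (-S x) ≤ 1 := by
      have h3 : 2 * Real.exp (-S x) ≤ χ y := sub_nonneg.1 hx.le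
      exact h3.trans (hχ1 _)
    rw [HasFDerivAt.fderiv (f := u) hud]
    have hK'0 : 0 ≤ ‖l‖ + K' * ‖P‖ := (norm_nonneg _).trans hS'n
    refine (norm_sub_le _ _).trans (add_le_add ?_ ?_)
    · refine (ContinuousLinearMap.opNorm_comp_le _ _).trans
        (mul_le_mul hχn ?_ (norm_nonneg _) K.2)
      rw [norm_smul, norm_inv, Real.norm_of_nonneg (show 0 ≤ r / 24 by positivity)]
      refine mul_le_mul_of_nonneg_left ((norm_sub_le _ _).trans (add_le_add le_rfl ?_))
        (by positivity)
      refine (ContinuousLinearMap.opNorm_comp_le _ _).trans ?_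
      rw [mul_comm]
      refine mul_le_mul hS'n ?_ (norm_nonneg _) hK'0
      simpa using hγn
    · rw [smul_neg, smul_neg, norm_neg, smul_smul, norm_smul, Real.norm_of_nonneg (by positivity)]
      exact mul_le_mul hexp hS'n (norm_nonneg _) zero_le_one

theorem exists_bump_fderiv_ne_zero (hX : ¬ FiniteDimensional ℝ X) {p : ℕ∞} (hp : 1 ≤ p)
    {b : X → ℝ} (hb : IsBump b) (hbp : ContDiff ℝ p b) :
    ∃ f : X → ℝ, f ≠ b ∧ IsBump f ∧ ContDiff ℝ p f ∧
      ((∃ K, LipschitzWith K b) → ∃ K, LipschitzWith K f) ∧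
      (∀ x, f x ∈ Set.Icc (0 : ℝ) 1) ∧ ∀ x ∈ interior (tsupport f), fderiv ℝ f x ≠ 0 := by
  have hp1 : (p : WithTop ℕ∞) ≠ 0 := by simpa using (zero_lt_one.trans_le hp).ne'
  obtain ⟨u, hu, hu', hbd, ⟨x₀, hx₀⟩, hu1, hL⟩ := exists_critical_point_free hX hp hb hbp
  -- The factor `a` makes the new bump different from `b`.
  obtain ⟨a, ha0, ha1, hne⟩ : ∃ a : ℝ, 0 < a ∧ a ≤ 1 ∧ a * expNegInvGlue (u x₀) ≠ b x₀ := by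
    by_cases h : 1 * expNegInvGlue (u x₀) = b x₀
    · refine ⟨1 / 2, by norm_num, by norm_num, ?_⟩
      rw [← h]
      linarith [expNegInvGlue.pos_of_pos hx₀]
    · exact ⟨1, one_pos, le_rfl, h⟩
  set f : X → ℝ := fun x => a * expNegInvGlue (u x) with hf
  have hsupp : tsupport f ⊆ {x | 0 ≤ u x} := by
    refine closure_minimal (fun x hx => ?_) (isClosed_le continuous_const hu.continuous)
    by_contra h
    exact hx (by simp [hf, expNegInvGlue.zero_of_nonpos (not_le.1 h).le])
  have hfd : ∀ x, HasFDerivAt f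
      (a • ((u x)⁻¹ ^ 2 * expNegInvGlue (u x)) • fderiv ℝ u x) x := fun x =>
    ((hasDerivAt_expNegInvGlue (u x)).comp_hasFDerivAt x
      (hu.differentiable hp1 x).hasFDerivAt).const_mul a
  refine ⟨f, fun h => hne (congrFun h x₀), ⟨⟨x₀, ?_⟩, hbd.subset hsupp⟩,
    contDiff_const.mul (expNegInvGlue.contDiff.comp hu), fun hbL => ?_, fun x => ?_, ?_⟩
  · exact (mul_pos ha0 (expNegInvGlue.pos_of_pos hx₀)).ne'
  · obtain ⟨K, hK⟩ := hL hbL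
    obtain ⟨G, hG⟩ := exists_abs_deriv_expNegInvGlue_le
    have hK0 : 0 ≤ K := (norm_nonneg _).trans (hK x₀ hx₀)
    have hG0 : 0 ≤ G := (abs_nonneg _).trans (hG 0 zero_le_one)
    refine ⟨⟨a * (G * K), by positivity⟩, lipschitzWith_of_nnnorm_fderiv_le
      (fun x => (hfd x).differentiableAt) fun x => ?_⟩
    change ‖fderiv ℝ f x‖ ≤ a * (G * K)
    rw [(hfd x).fderiv, norm_smul, norm_smul, Real.norm_of_nonneg ha0.le]
    refine mul_le_mul_of_nonneg_left ?_ ha0.le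
    rcases le_or_gt (u x) 0 with h | h
    · rw [expNegInvGlue.zero_of_nonpos h, mul_zero, norm_zero, zero_mul]
      positivity
    · rw [← (hasDerivAt_expNegInvGlue (u x)).deriv]
      exact mul_le_mul (hG _ (hu1 x)) (hK x h) (norm_nonneg _) hG0
  · exact ⟨mul_nonneg ha0.le (expNegInvGlue.nonneg _),
      mul_le_one₀ ha1 (expNegInvGlue.nonneg _) (expNegInvGlue_le_one _)⟩
  · intro x hx
    rcases (show 0 ≤ u x from hsupp (interior_subset hx)).eq_or_lt with h | h
    · -- A zero of `u` in the interior of the support would be a local minimum of `u`.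
      refine absurd (IsLocalMin.fderiv_eq_zero (f := u) ?_) (hu' x)
      filter_upwards [mem_interior_iff_mem_nhds.1 hx] with y hy
      rw [← h]
      exact hsupp hy
    · rw [(hfd x).fderiv]
      exact smul_ne_zero ha0.ne' (smul_ne_zero
        (mul_pos (by positivity) (expNegInvGlue.pos_of_pos h)).ne' (hu' x))

theorem not_rolleHolds_of_bump {f : X → ℝ} (hf : IsBump f) (hd : Differentiable ℝ f)
    (hf' : ∀ x ∈ interior (tsupport f), fderiv ℝ f x ≠ 0) : ¬ RolleHolds X := by
  intro hR
  have hsub : {x | f x ≠ 0} ⊆ interior (tsupport f) :=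
    interior_maximal subset_closure (isOpen_ne_fun hd.continuous continuous_const)
  obtain ⟨x, hx, h0⟩ := hR (interior (tsupport f)) (hf.1.imp fun x hx => hsub hx)
    (hf.2.subset interior_subset) isOpen_interior f hd.continuous.continuousOn
    hd.differentiableOn ⟨0, fun x hx => by
      by_contra h
      rw [isOpen_interior.frontier_eq] at hx
      exact hx.2 (hsub h)⟩
  exact hf' x hx h0

end Tube

theorem theorem1p1 {X : Type*} [NormedAddCommGroup X] [NormedSpace ℝ X] [CompleteSpace X]
    (hX : ¬ FiniteDimensional ℝ X) (p : ℕ∞) (hp : 1 ≤ p) :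
    -- the version without the Lipschitz condition
    (∀ b : X → ℝ, IsBump b → ContDiff ℝ p b →
      ∃ f : X → ℝ, f ≠ b ∧ IsBump f ∧ ContDiff ℝ p f ∧ (∀ x, f x ∈ Set.Icc (0 : ℝ) 1) ∧
        ∀ x ∈ interior (tsupport f), fderiv ℝ f x ≠ 0) ∧
    -- the Lipschitz version
    (∀ b : X → ℝ, IsBump b → ContDiff ℝ p b → (∃ K, LipschitzWith K b) →
      ∃ f : X → ℝ, f ≠ b ∧ IsBump f ∧ ContDiff ℝ p f ∧ (∃ K, LipschitzWith K f) ∧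
        (∀ x, f x ∈ Set.Icc (0 : ℝ) 1) ∧
        ∀ x ∈ interior (tsupport f), fderiv ℝ f x ≠ 0) ∧
    -- hence Rolle's theorem fails
    ((∃ b : X → ℝ, IsBump b ∧ ContDiff ℝ p b) → ¬ RolleHolds X) := by
  refine ⟨fun b hb hbp => ?_, fun b hb hbp hL => ?_, ?_⟩
  · obtain ⟨f, h1, h2, h3, -, h5, h6⟩ := exists_bump_fderiv_ne_zero hX hp hb hbp
    exact ⟨f, h1, h2, h3, h5, h6⟩
  · obtain ⟨f, h1, h2, h3, h4, h5, h6⟩ := exists_bump_fderiv_ne_zero hX hp hb hbp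
    exact ⟨f, h1, h2, h3, h4 hL, h5, h6⟩
  · rintro ⟨b, hb, hbp⟩
    obtain ⟨f, -, h2, h3, -, -, h6⟩ := exists_bump_fderiv_ne_zero hX hp hb hbp
    exact not_rolleHolds_of_bump h2
      (h3.differentiable (by simpa using (zero_lt_one.trans_le hp).ne')) h6
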